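/- Let $x_1,x_2,\ldots$ be fixed covariates in $\mathcal X$, let $m\ge 1$ be fixed, and let $\lambda$ be a $\sigma$-finite measure on the response space $\mathcal Y$. For $k=0,1,\ldots,K$, the model $\mathcal M_k$ consists of a parameter space $\Theta_k$, a probability prior $\pi_k$ on $\Theta_k$ that has a density with respect to some $\sigma$-finite measure, and conditional densities $f_k(\cdot\mid\theta,x_i,y_1,\ldots,y_{i-1})$ with respect to $\lambda$. Given $\theta\in\Theta_k$, the $m$ replicates $(y_{1j},y_{2j},\ldots)$, $j\le m$, are independent, so that the data $\mathbf Y_{nm}=(y_{ij})_{i\le n,\,j\le m}$ have density $$f_k(\mathbf Y_{nm}\mid\theta)=\prod_{j=1}^m\prod_{i=1}^n f_k(y_{ij}\mid\theta,x_i,y_{1j},\ldots,y_{i-1,j}).$$ The true model is $\mathcal M_0$: the data are generated from $P$, under which $\mathbf Y_{nm}$ has density $f_0(\mathbf Y_{nm})=\int f_0(\mathbf Y_{nm}\mid\theta)\,d\pi_0(\theta)$ for every $n$. It need not be among the competing models $\mathcal M_1,\ldots,\mathcal M_K$, whose prior densities are assumed to be positive everywhere. For $k\ge1$ and $\theta\in\Theta_k$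 put $R_n^k(\theta)=f_k(\mathbf Y_{nm}\mid\theta)/f_0(\mathbf Y_{nm})$, and for measurable $A\subseteq\Theta_k$ let $h_k(A)$ be the $\pi_k$-essential infimum over $A$ of the rate $h_k$ in (S2). Let $I_k=\{\theta\in\Theta_k:h_k(\theta)=\infty\}$. Assume that for each $k=1,\ldots,K$: (S1) $R^k_n(\theta)$ is measurable with respect to the product of $\sigma(\mathbf Y_{nm})$ and the $\sigma$-field of $\Theta_k$, for all $n$. (S2) For every $\theta\in\Theta_k$ the limit $h_k(\theta)=\lim_{n\to\infty}\frac1n E_P\log\frac{f_0(\mathbf Y_{nm})}{f_k(\mathbf Y_{nm}\mid\theta)}$ exists in $[0,\infty]$, and $h_k$ is measurable. (S3) For every $\theta\in\Theta_k$, $\frac1n\log R_n^k(\theta)\to-h_k(\theta)$ $P$-almost surely. (S4) $\pi_k(I_k)<1$. (S5) There are measurable sets $\mathcal G^k_n\to\Theta_k$ (every $\theta\in\Theta_k$ lies in $\mathcal G_n^k$ for all large $n$) such that (1) $\pi_k(\mathcal G^k_n)\ge 1-c\,e^{-\gamma n}$ for all $n$, for some $c>0$ and $\gamma>2h_k(\Theta_k)$;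 (2) for each $N$, $P$-almost surely, the convergence in (S3) is uniform over $\theta\in\mathcal G^k_N\setminus I_k$; (3) $h_k(\mathcal G^k_n)\to h_k(\Theta_k)$. (S6) For measurable $A$ and $\delta>0$ let $\tau(A,\delta)$ be the least random $t\in\{0,1,2,\ldots,\infty\}$ such that for all $n>t$ $$\frac1n\log\int_A R^k_n\,d\pi_k\le\delta+\limsup_{l\to\infty}\frac1l\log\int_A R^k_l\,d\pi_k .$$ The sets of (S5) are such that for every $\delta>0$, $P$-almost surely, $n>\tau(\mathcal G^k_n,\delta)$ for all sufficiently large $n$. The models are combined in a mixture: the weights $(p_1,\ldots,p_K)$ in the probability simplex have a prior distribution $\rho$, the allocation variable $\zeta$ satisfies $\mathbb P(\zeta=k\mid p_1,\ldots,p_K)=p_k$, and given $\zeta=k$ the parameter has prior $\pi_k$ and the data come from $\mathcal M_k$. Let $\tilde k$ be the unique minimizer of $h_k(\Theta_k)$, that is, $h_{\tilde k}(\Theta_{\tilde k})<h_k(\Theta_k)$ for all $k\ne\tilde k$, and suppose that $p_{\tilde k}>0$ with positive $\rho$-probability. Suppose moreover that for each $k\ne\tilde k$ and each $N$, $P$-almost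 surely, $\frac1n\log R^k_n(\theta)\to-\infty$ as $n\to\infty$, uniformly over $\theta\in\mathcal G^k_N\cap I_k$ up to sets of $\pi_k$-measure zero; this holds trivially if $\pi_k(I_k)=0$. Then $$\lim_{n\to\infty}\pi(\zeta=k\mid\mathbf X_n,\mathbf Y_{nm})=\begin{cases}1&\text{if }k=\tilde k,\\0&\text{if }k\neq\tilde k,\end{cases}\qquad P\text{-almost surely.}$$ -/

import Mathlib

open MeasureTheory Filter Topology
open scoped NNReal ENNReal

noncomputable section

/-- A regression model for responses in `𝒴` at covariates in `𝒳`, with parameter `θ : Θ`.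
Observations are numbered from `0`, and `dens i θ x h y` is the conditional density
`f(y | θ, x, h)`, with respect to `lam`, of the `i`-th response given the covariate `x` and the
`i` earlier responses `h` of the same replicate. -/
structure RegressionModel (Θ 𝒳 𝒴 : Type*) [MeasurableSpace 𝒴] (lam : Measure 𝒴) where
  dens : (i : ℕ) → Θ → 𝒳 → (Fin i → 𝒴) → 𝒴 → ℝ≥0
  measurable_dens : ∀ i θ x, Measurable (fun q : (Fin i → 𝒴) × 𝒴 => dens i θ x q.1 q.2)
  lintegral_dens : ∀ i θ x h, ∫⁻ y, (dens i θ x h y : ℝ≥0∞) ∂lam = 1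

/-- A regression model together with a proper prior on its parameter space, given by a density
with respect to a sigma-finite measure. -/
structure BayesModel (Θ 𝒳 𝒴 : Type*) [MeasurableSpace Θ] [MeasurableSpace 𝒴]
    (lam : Measure 𝒴) extends RegressionModel Θ 𝒳 𝒴 lam where
  priorBase : Measure Θ
  sigmaFinite_priorBase : SigmaFinite priorBase
  priorDens : Θ → ℝ≥0
  measurable_priorDens : Measurable priorDens
  lintegral_priorDens : ∫⁻ θ, (priorDens θ : ℝ≥0∞) ∂priorBase = 1

/-- Reference measure for arrays `(y_{ij})`, `i < n`, `j < m`: the product of copies of `lam`. -/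
def refMeasure {𝒴 : Type*} [MeasurableSpace 𝒴] (lam : Measure 𝒴) (n m : ℕ) :
    Measure (Fin n → Fin m → 𝒴) :=
  Measure.pi fun _ => Measure.pi fun _ => lam

/-- The data `Y_{nm}`: the first `n` rows of the array of responses. -/
def dataUpTo {Ω 𝒴 : Type*} {m : ℕ} (Y : ℕ → Fin m → Ω → 𝒴) (n : ℕ) (ω : Ω) :
    Fin n → Fin m → 𝒴 :=
  fun i j => Y i j ω

namespace RegressionModel

variable {Θ 𝒳 𝒴 : Type*} [MeasurableSpace 𝒴] {lam : Measure 𝒴}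

/-- The likelihood `f(Y_{nm} | X_n, θ)`: the `m` replicates are independent given `θ`, and
within a replicate the conditional densities are multiplied. -/
def lik (M : RegressionModel Θ 𝒳 𝒴 lam) (x : ℕ → 𝒳) {n m : ℕ} (θ : Θ)
    (y : Fin n → Fin m → 𝒴) : ℝ≥0∞ :=
  ∏ j : Fin m, ∏ i : Fin n,
    (M.dens i θ (x i) (fun l : Fin i => y (Fin.castLE i.isLt.le l) j) (y i j) : ℝ≥0∞)

/-- The distribution of `Y_{nm}` under the parameter `θ`. -/
def dist (M : RegressionModel Θ 𝒳 𝒴 lam) (x : ℕ → 𝒳) (n m : ℕ) (θ : Θ) :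
    Measure (Fin n → Fin m → 𝒴) :=
  (refMeasure lam n m).withDensity (M.lik x θ)

end RegressionModel

namespace BayesModel

section Basic

variable {Θ 𝒳 𝒴 : Type*} [MeasurableSpace Θ] [MeasurableSpace 𝒴] {lam : Measure 𝒴}

/-- The prior as a probability measure. -/
def prior (M : BayesModel Θ 𝒳 𝒴 lam) : Measure Θ :=
  M.priorBase.withDensity fun θ => (M.priorDens θ : ℝ≥0∞)

/-- The marginal density `∫ f(Y_{nm} | X_n, θ) π(dθ)`. -/
def marginal (M : BayesModel Θ 𝒳 𝒴 lam) (x : ℕ → 𝒳) {n m : ℕ}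
    (y : Fin n → Fin m → 𝒴) : ℝ≥0∞ :=
  ∫⁻ θ, M.lik x θ y ∂M.prior

end Basic

/-! ### The conditions on a competing model `M`

The true model is `M₀`, and `Y` is the array of responses, a random variable on `(Ω, P)`. -/

section Conditions

variable {Θ Θ₀ 𝒳 𝒴 Ω : Type*} [MeasurableSpace Θ] [MeasurableSpace Θ₀] [MeasurableSpace 𝒴]
  [MeasurableSpace Ω] {lam : Measure 𝒴} {m : ℕ}

/-- The likelihood ratio `R_n(θ)` of `M` at `θ` against the true model, at the observed data. -/
def ratio (M : BayesModel Θ 𝒳 𝒴 lam) (M₀ : BayesModel Θ₀ 𝒳 𝒴 lam) (x : ℕ → 𝒳)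
    (Y : ℕ → Fin m → Ω → 𝒴) (n : ℕ) (θ : Θ) (ω : Ω) : ℝ≥0∞ :=
  M.lik x θ (dataUpTo Y n ω) / M₀.marginal x (dataUpTo Y n ω)

/-- `n⁻¹ log R_n(θ)`, with values in the extended reals. -/
def logRatioRate (M : BayesModel Θ 𝒳 𝒴 lam) (M₀ : BayesModel Θ₀ 𝒳 𝒴 lam) (x : ℕ → 𝒳)
    (Y : ℕ → Fin m → Ω → 𝒴) (n : ℕ) (θ : Θ) (ω : Ω) : EReal :=
  ENNReal.log (M.ratio M₀ x Y n θ ω) / (n : EReal)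

/-- `n⁻¹ log ∫_A R_n(θ) π(dθ)`, with values in the extended reals. -/
def logIntegralRate (M : BayesModel Θ 𝒳 𝒴 lam) (M₀ : BayesModel Θ₀ 𝒳 𝒴 lam) (x : ℕ → 𝒳)
    (Y : ℕ → Fin m → Ω → 𝒴) (A : Set Θ) (n : ℕ) (ω : Ω) : EReal :=
  ENNReal.log (∫⁻ θ in A, M.ratio M₀ x Y n θ ω ∂M.prior) / (n : EReal)

/-- `n⁻¹` times the Kullback-Leibler divergence `E log (f_{θ₀}(Y_{nm}) / f_θ(Y_{nm}))` of the
distribution of the data under `θ` from the true one. -/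
def klPerObs (M : BayesModel Θ 𝒳 𝒴 lam) (P : Measure Ω) (x : ℕ → 𝒳)
    (Y : ℕ → Fin m → Ω → 𝒴) (θ : Θ) (n : ℕ) : ℝ≥0∞ :=
  InformationTheory.klDiv (P.map (dataUpTo Y n)) (M.dist x n m θ) / (n : ℝ≥0∞)

/-- The KL-divergence rate `h(θ)`. It is an upper limit here so that it is always defined;
condition (S2) says that it is a limit. -/
def klRate (M : BayesModel Θ 𝒳 𝒴 lam) (P : Measure Ω) (x : ℕ → 𝒳)
    (Y : ℕ → Fin m → Ω → 𝒴) (θ : Θ) : ℝ≥0∞ :=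
  limsup (M.klPerObs P x Y θ) atTop

/-- `h(A)`, the essential infimum of `h` over `A` with respect to the prior. -/
def klRateOn (M : BayesModel Θ 𝒳 𝒴 lam) (P : Measure Ω) (x : ℕ → 𝒳)
    (Y : ℕ → Fin m → Ω → 𝒴) (A : Set Θ) : ℝ≥0∞ :=
  essInf (M.klRate P x Y) (M.prior.restrict A)

/-- The set `I` of parameters at which the KL-divergence rate is infinite. -/
def infSet (M : BayesModel Θ 𝒳 𝒴 lam) (P : Measure Ω) (x : ℕ → 𝒳)
    (Y : ℕ → Fin m → Ω → 𝒴) : Set Θ :=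
  {θ | M.klRate P x Y θ = ∞}

/-- `τ(A, δ)`: the least `t` such that
`n⁻¹ log ∫_A R_n dπ ≤ δ + limsup_n n⁻¹ log ∫_A R_n dπ` for all `n > t` (infinite if there is
none; the inequality is trivial if the upper limit is `+∞`). -/
def settlingTime (M : BayesModel Θ 𝒳 𝒴 lam) (M₀ : BayesModel Θ₀ 𝒳 𝒴 lam) (x : ℕ → 𝒳)
    (Y : ℕ → Fin m → Ω → 𝒴) (A : Set Θ) (δ : ℝ) (ω : Ω) : ℕ∞ :=
  ⨅ (t : ℕ) (_ : ∀ n > t, M.logIntegralRate M₀ x Y A n ω ≤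
      (δ : EReal) + limsup (fun l => M.logIntegralRate M₀ x Y A l ω) atTop), (t : ℕ∞)

/-- (S1) `R_n(θ)` is measurable with respect to the product of the sigma-field generated by
`Y_{nm}` and that of the parameter space. -/
def S1 (M : BayesModel Θ 𝒳 𝒴 lam) (M₀ : BayesModel Θ₀ 𝒳 𝒴 lam) (x : ℕ → 𝒳)
    (Y : ℕ → Fin m → Ω → 𝒴) : Prop :=
  ∀ n, Measurable[(MeasurableSpace.comap (dataUpTo Y n) inferInstance).prod
      (inferInstanceAs (MeasurableSpace Θ))]
    fun q : Ω × Θ => M.ratio M₀ x Y n q.2 q.1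

/-- (S2) The KL-divergence rate exists as a limit, possibly infinite, and is measurable. -/
def S2 (M : BayesModel Θ 𝒳 𝒴 lam) (P : Measure Ω) (x : ℕ → 𝒳)
    (Y : ℕ → Fin m → Ω → 𝒴) : Prop :=
  (∀ θ, Tendsto (M.klPerObs P x Y θ) atTop (𝓝 (M.klRate P x Y θ))) ∧
    Measurable (M.klRate P x Y)

/-- (S3) The asymptotic equipartition property at every parameter. -/
def S3 (M : BayesModel Θ 𝒳 𝒴 lam) (M₀ : BayesModel Θ₀ 𝒳 𝒴 lam) (P : Measure Ω) (x : ℕ → 𝒳)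
    (Y : ℕ → Fin m → Ω → 𝒴) : Prop :=
  ∀ θ, ∀ᵐ ω ∂P, Tendsto (fun n => M.logRatioRate M₀ x Y n θ ω) atTop
    (𝓝 (-(M.klRate P x Y θ : EReal)))

/-- (S4) The prior probability of an infinite KL-divergence rate is less than `1`. -/
def S4 (M : BayesModel Θ 𝒳 𝒴 lam) (P : Measure Ω) (x : ℕ → 𝒳)
    (Y : ℕ → Fin m → Ω → 𝒴) : Prop :=
  M.prior (M.infSet P x Y) < 1

/-- (S5) for the sieve `G`: the sets converge to the whole parameter space, have exponentially
small complements, the convergence in (S3) is uniform over each `G N` without `I`, and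
`h(G n)` tends to `h(Θ)`. -/
def S5 (M : BayesModel Θ 𝒳 𝒴 lam) (M₀ : BayesModel Θ₀ 𝒳 𝒴 lam) (P : Measure Ω) (x : ℕ → 𝒳)
    (Y : ℕ → Fin m → Ω → 𝒴) (G : ℕ → Set Θ) : Prop :=
  (∀ n, MeasurableSet (G n)) ∧
  (∀ θ, ∀ᶠ n in atTop, θ ∈ G n) ∧
  (∃ c γ : ℝ, 0 < c ∧ 2 * M.klRateOn P x Y Set.univ < ENNReal.ofReal γ ∧
    ∀ n : ℕ, 1 - c * Real.exp (-γ * n) ≤ M.prior.real (G n)) ∧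
  (∀ N, ∀ᵐ ω ∂P, ∀ ε : ℝ, 0 < ε → ∀ᶠ n in atTop, ∀ θ ∈ G N \ M.infSet P x Y,
    -(M.klRate P x Y θ : EReal) - (ε : EReal) ≤ M.logRatioRate M₀ x Y n θ ω ∧
    M.logRatioRate M₀ x Y n θ ω ≤ -(M.klRate P x Y θ : EReal) + (ε : EReal)) ∧
  Tendsto (fun n => M.klRateOn P x Y (G n)) atTop (𝓝 (M.klRateOn P x Y Set.univ))

/-- (S6) for the sieve `G`: for every `δ > 0`, almost surely `n > τ(G n, δ)` for all
sufficiently large `n`. -/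
def S6 (M : BayesModel Θ 𝒳 𝒴 lam) (M₀ : BayesModel Θ₀ 𝒳 𝒴 lam) (P : Measure Ω) (x : ℕ → 𝒳)
    (Y : ℕ → Fin m → Ω → 𝒴) (G : ℕ → Set Θ) : Prop :=
  ∀ δ : ℝ, 0 < δ → ∀ᵐ ω ∂P, ∀ᶠ n : ℕ in atTop,
    M.settlingTime M₀ x Y (G n) δ ω < (n : ℕ∞)

/-- On `I` the ratios `n⁻¹ log R_n(θ)` tend to `-∞` uniformly over every set of the sieve `G`,
up to sets of prior probability zero. This holds trivially if `I` has prior probability zero. -/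
def UniformOnInfSet (M : BayesModel Θ 𝒳 𝒴 lam) (M₀ : BayesModel Θ₀ 𝒳 𝒴 lam) (P : Measure Ω)
    (x : ℕ → 𝒳) (Y : ℕ → Fin m → Ω → 𝒴) (G : ℕ → Set Θ) : Prop :=
  ∀ N, ∀ᵐ ω ∂P, ∀ C : ℝ, ∀ᶠ n in atTop,
    ∀ᵐ θ ∂(M.prior.restrict (G N ∩ M.infSet P x Y)), M.logRatioRate M₀ x Y n θ ω ≤ (C : EReal)

end Conditions

end BayesModel

/-- The joint density of the event `ζ = k` and the data `y` in the mixture of the models `M k`: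
the weights `p` have prior `ρ`, given `p` the allocation variable `ζ` equals `k` with
probability `p k`, and given `ζ = k` the data come from `M k`. -/
def allocationDensity {K : ℕ} {Θ : Fin K → Type*} {𝒳 𝒴 : Type*} [∀ k, MeasurableSpace (Θ k)]
    [MeasurableSpace 𝒴] {lam : Measure 𝒴} (M : ∀ k, BayesModel (Θ k) 𝒳 𝒴 lam)
    (ρ : Measure (stdSimplex ℝ (Fin K))) (x : ℕ → 𝒳) {n m : ℕ} (y : Fin n → Fin m → 𝒴)
    (k : Fin K) : ℝ≥0∞ :=
  ∫⁻ p, ENNReal.ofReal (p.1 k) * (∫⁻ θ, (M k).lik x θ y ∂(M k).prior) ∂ρ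

/-- The posterior probability `π(ζ = k | X_n, Y_{nm})`, by Bayes' formula. -/
def allocationPosterior {K : ℕ} {Θ : Fin K → Type*} {𝒳 𝒴 : Type*} [∀ k, MeasurableSpace (Θ k)]
    [MeasurableSpace 𝒴] {lam : Measure 𝒴} (M : ∀ k, BayesModel (Θ k) 𝒳 𝒴 lam)
    (ρ : Measure (stdSimplex ℝ (Fin K))) (x : ℕ → 𝒳) {n m : ℕ} (y : Fin n → Fin m → 𝒴)
    (k : Fin K) : ℝ≥0∞ :=
  allocationDensity M ρ x y k / ∑ l, allocationDensity M ρ x y l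

end

/-! Dividing every marginal density by the true one cancels from the posterior, so models compete
through their integrated likelihood ratios `J k n = ∫ R_n dπ_k`. Each is compared with exponentials
of rate `h_k(Θ_k)`: from below for the best model, from above for the others.

Lower bound (`exists_le_lintegral_ratio`): if `u` exceeds the rate, the parameters with `h < u` have
positive prior mass, and there `e^{nu} R_n` is eventually at least `1`; Fatou keeps `e^{nu} J` away
from `0`.

Upper bound (`ae_eventually_lintegral_ratio_le`): for `v` below the rate, split the integral at the
sieve set `G n`. Off the sieve, `R_n` has expectation at most `1`, so the integral has exponentially
small expectation and Borel-Cantelli applies. On a fixed `G N`, uniform convergence bounds the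
limsup by `-v`; (S6) transfers this to the moving set `G n`.

With `u < v` strictly between the best rate and a competitor's, the competitor's share is
`O(e^{n(u-v)})`. `ENNReal.tendsto_normalized` turns this into convergence of the posterior. -/

/-! ### Likelihoods as probability densities -/

/-- Tonelli's theorem for a product of functions of the separate coordinates. -/
theorem lintegral_pi_prod {α : Type*} [MeasurableSpace α] (μ : Measure α) [SigmaFinite μ] {m : ℕ}
    (g : Fin m → α → ℝ≥0∞) (hg : ∀ j, Measurable (g j)) :
    ∫⁻ y, ∏ j, g j (y j) ∂(Measure.pi fun _ : Fin m => μ) = ∏ j, ∫⁻ y, g j y ∂μ := by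
  induction m with
  | zero => simp
  | succ m ih =>
    have hmp := measurePreserving_piFinSuccAbove (fun _ : Fin (m + 1) => μ) 0
    have hF : Measurable fun z : α × (Fin m → α) => g 0 z.1 * ∏ j, g j.succ (z.2 j) := by
      fun_prop
    calc ∫⁻ y, ∏ j, g j (y j) ∂(Measure.pi fun _ : Fin (m + 1) => μ)
        = ∫⁻ z : α × (Fin m → α), g 0 z.1 * ∏ j, g j.succ (z.2 j)
            ∂(μ.prod (Measure.pi fun _ => μ)) := by
          rw [← hmp.lintegral_comp hF]
          refine lintegral_congr fun y => ?_
          rw [Fin.prod_univ_succ]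
          rfl
      _ = ∏ j, ∫⁻ y, g j y ∂μ := by
          rw [lintegral_prod_mul (f := g 0) (g := fun w : Fin m → α => ∏ j, g j.succ (w j))
            (hg 0).aemeasurable (Measurable.aemeasurable (by fun_prop)), ih _ fun j => hg _,
            Fin.prod_univ_succ]

instance refMeasure_sigmaFinite {𝒴 : Type*} [MeasurableSpace 𝒴] (lam : Measure 𝒴)
    [SigmaFinite lam] (n m : ℕ) : SigmaFinite (refMeasure lam n m) := by
  unfold refMeasure; infer_instance

namespace RegressionModel

variable {Θ 𝒳 𝒴 : Type*} [MeasurableSpace 𝒴] {lam : Measure 𝒴}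

theorem measurable_lik (M : RegressionModel Θ 𝒳 𝒴 lam) (x : ℕ → 𝒳) (n m : ℕ) (θ : Θ) :
    Measurable (M.lik x θ : (Fin n → Fin m → 𝒴) → ℝ≥0∞) := by
  unfold lik
  refine Finset.measurable_prod _ fun j _ => Finset.measurable_prod _ fun i _ => ?_
  exact ((M.measurable_dens i θ (x i)).comp (g := fun q : (Fin i → 𝒴) × 𝒴 =>
    M.dens i θ (x i) q.1 q.2) (f := fun y : Fin n → Fin m → 𝒴 =>
      (fun l : Fin i => y (Fin.castLE i.isLt.le l) j, y i j)) (by fun_prop)).coe_nnreal_ennreal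

/-- Joint measurability of the likelihood in the parameter and the data. -/
theorem measurable_lik_uncurry [MeasurableSpace Θ] (M : RegressionModel Θ 𝒳 𝒴 lam) (x : ℕ → 𝒳)
    (hM : ∀ i, Measurable (fun q : Θ × (Fin i → 𝒴) × 𝒴 => M.dens i q.1 (x i) q.2.1 q.2.2))
    (n m : ℕ) :
    Measurable fun q : (Fin n → Fin m → 𝒴) × Θ => M.lik x q.2 q.1 := by
  unfold lik
  refine Finset.measurable_prod _ fun j _ => Finset.measurable_prod _ fun i _ => ?_
  exact ((hM i).comp (g := fun q : Θ × (Fin i → 𝒴) × 𝒴 =>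
    M.dens i q.1 (x i) q.2.1 q.2.2) (f := fun y : (Fin n → Fin m → 𝒴) × Θ =>
      (y.2, fun l : Fin i => y.1 (Fin.castLE i.isLt.le l) j, y.1 i j))
      (by fun_prop)).coe_nnreal_ennreal

/-- The likelihood is a probability density. -/
theorem lintegral_lik [SigmaFinite lam] (M : RegressionModel Θ 𝒳 𝒴 lam) (x : ℕ → 𝒳) (n m : ℕ)
    (θ : Θ) : ∫⁻ y, M.lik x θ y ∂(refMeasure lam n m) = 1 := by
  induction n with
  | zero => simp [refMeasure, lik]
  | succ n ih =>
    -- Splitting off the last row leaves the histories of all earlier rows untouched.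
    have hmp := measurePreserving_piFinSuccAbove
      (fun _ : Fin (n + 1) => Measure.pi fun _ : Fin m => lam) (Fin.last n)
    have hd : Measurable fun q : (Fin m → 𝒴) × (Fin n → Fin m → 𝒴) =>
        ∏ j, (M.dens n θ (x n) (fun l => q.2 l j) (q.1 j) : ℝ≥0∞) := by
      refine Finset.measurable_prod _ fun j _ => ?_
      exact ((M.measurable_dens n θ (x n)).comp (g := fun q : (Fin n → 𝒴) × 𝒴 =>
        M.dens n θ (x n) q.1 q.2) (f := fun q : (Fin m → 𝒴) × (Fin n → Fin m → 𝒴) =>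
          (fun l => q.2 l j, q.1 j)) (by fun_prop)).coe_nnreal_ennreal
    have hF : Measurable fun q : (Fin m → 𝒴) × (Fin n → Fin m → 𝒴) => M.lik x θ q.2 *
        ∏ j, (M.dens n θ (x n) (fun l => q.2 l j) (q.1 j) : ℝ≥0∞) :=
      ((M.measurable_lik x n m θ).comp measurable_snd).mul hd
    have hrow (w : Fin n → Fin m → 𝒴) :
        ∫⁻ z, ∏ j, (M.dens n θ (x n) (fun l => w l j) (z j) : ℝ≥0∞)
          ∂(Measure.pi fun _ : Fin m => lam) = 1 := by
      rw [lintegral_pi_prod lam (fun j z => (M.dens n θ (x n) (fun l => w l j) z : ℝ≥0∞))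
        fun j => ((M.measurable_dens n θ (x n)).comp measurable_prodMk_left).coe_nnreal_ennreal]
      simp [M.lintegral_dens]
    calc ∫⁻ y, M.lik x θ y ∂(refMeasure lam (n + 1) m)
        = ∫⁻ q, M.lik x θ q.2 * ∏ j, (M.dens n θ (x n) (fun l => q.2 l j) (q.1 j) : ℝ≥0∞)
            ∂((Measure.pi fun _ : Fin m => lam).prod (refMeasure lam n m)) := by
          refine Eq.trans ?_ (hmp.lintegral_comp hF)
          refine lintegral_congr fun y => ?_
          simp only [lik, MeasurableEquiv.piFinSuccAbove_apply, Fin.insertNthEquiv_symm_apply,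
            Fin.removeNth, Fin.succAbove_last, Fin.prod_univ_castSucc, Finset.prod_mul_distrib]
          rfl
      _ = 1 := by
          rw [lintegral_prod_symm _ hF.aemeasurable]
          simp_rw [lintegral_const_mul' _ _ (show (M.lik x θ _ : ℝ≥0∞) ≠ ∞ from
            ENNReal.prod_ne_top fun _ _ => ENNReal.prod_ne_top fun _ _ => ENNReal.coe_ne_top),
            hrow, mul_one, ih]

end RegressionModel

/-! ### Exponential bounds and measurability of the data -/

/-- Bounds on `n⁻¹ log a` as bounds on `a`. -/
theorem ENNReal.log_div_natCast_le_iff {a : ℝ≥0∞} {n : ℕ} (hn : 0 < n) (r : ℝ) :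
    ENNReal.log a / (n : EReal) ≤ (r : EReal) ↔ a ≤ ENNReal.ofReal (Real.exp (n * r)) := by
  rw [EReal.div_le_iff_le_mul (by exact_mod_cast hn) (EReal.natCast_ne_top n),
    ← ENNReal.log_le_log_iff, ENNReal.log_ofReal_of_pos (Real.exp_pos _), Real.log_exp]
  norm_cast

theorem ENNReal.le_log_div_natCast_iff {a : ℝ≥0∞} {n : ℕ} (hn : 0 < n) (r : ℝ) :
    (r : EReal) ≤ ENNReal.log a / (n : EReal) ↔ ENNReal.ofReal (Real.exp (n * r)) ≤ a := by
  rw [EReal.le_div_iff_mul_le (by exact_mod_cast hn) (EReal.natCast_ne_top n),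
    ← ENNReal.log_le_log_iff, ENNReal.log_ofReal_of_pos (Real.exp_pos _), Real.log_exp, mul_comm]
  norm_cast

theorem measurable_dataUpTo {Ω 𝒴 : Type*} [MeasurableSpace Ω] [MeasurableSpace 𝒴] {m : ℕ}
    {Y : ℕ → Fin m → Ω → 𝒴} (hY : ∀ i j, Measurable (Y i j)) (n : ℕ) :
    Measurable (dataUpTo Y n) :=
  measurable_pi_lambda _ fun i => measurable_pi_lambda _ fun j => hY i j

namespace BayesModel

variable {Θ Θ₀ 𝒳 𝒴 Ω : Type*} [MeasurableSpace Θ] [MeasurableSpace Θ₀] [MeasurableSpace 𝒴]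
  [MeasurableSpace Ω] {lam : Measure 𝒴} {m : ℕ}

instance isProbabilityMeasure_prior (M : BayesModel Θ 𝒳 𝒴 lam) :
    IsProbabilityMeasure M.prior :=
  ⟨by rw [prior, withDensity_apply _ MeasurableSet.univ, setLIntegral_univ,
    M.lintegral_priorDens]⟩

theorem measurable_marginal (M₀ : BayesModel Θ₀ 𝒳 𝒴 lam) (x : ℕ → 𝒳)
    (hM₀ : ∀ i, Measurable (fun q : Θ₀ × (Fin i → 𝒴) × 𝒴 => M₀.dens i q.1 (x i) q.2.1 q.2.2))
    (n m : ℕ) : Measurable (M₀.marginal x : (Fin n → Fin m → 𝒴) → ℝ≥0∞) :=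
  (M₀.measurable_lik_uncurry x hM₀ n m).lintegral_prod_right'

/-! ### Likelihood ratios under the true distribution -/

section TrueModel

variable {M : BayesModel Θ 𝒳 𝒴 lam} {M₀ : BayesModel Θ₀ 𝒳 𝒴 lam} {x : ℕ → 𝒳}
  {P : Measure Ω} {Y : ℕ → Fin m → Ω → 𝒴}

/-- Almost surely the true marginal density is positive and finite at all the data. -/
theorem ae_marginal_ne_zero_ne_top [IsProbabilityMeasure P] (hY : ∀ i j, Measurable (Y i j))
    (hM₀ : ∀ i, Measurable (fun q : Θ₀ × (Fin i → 𝒴) × 𝒴 => M₀.dens i q.1 (x i) q.2.1 q.2.2))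
    (htrue : ∀ n, P.map (dataUpTo Y n) = (refMeasure lam n m).withDensity (M₀.marginal x)) :
    ∀ᵐ ω ∂P, ∀ n, M₀.marginal x (dataUpTo Y n ω) ≠ 0 ∧ M₀.marginal x (dataUpTo Y n ω) ≠ ∞ := by
  rw [ae_all_iff]
  intro n
  have hf := M₀.measurable_marginal x hM₀ n m
  refine ae_of_ae_map (p := fun y => M₀.marginal x y ≠ 0 ∧ M₀.marginal x y ≠ ∞)
    (measurable_dataUpTo hY n).aemeasurable ?_
  -- Positivity is automatic, since a density gives no mass to its zero set; only finiteness needs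
  -- an argument.
  rw [htrue n, ae_withDensity_iff hf]
  have hfin : ∫⁻ y, M₀.marginal x y ∂(refMeasure lam n m) ≠ ∞ := by
    rw [← setLIntegral_univ, ← withDensity_apply _ MeasurableSet.univ, ← htrue n]
    have := Measure.isProbabilityMeasure_map (μ := P) (measurable_dataUpTo hY n).aemeasurable
    exact measure_ne_top _ _
  filter_upwards [ae_lt_top hf hfin] with y hy h0 using ⟨h0, hy.ne⟩

/-- Changing measure cancels the true density. Equality can fail because the likelihood may charge
the set where the true density vanishes. -/
theorem lintegral_ratio_le_one [SigmaFinite lam] (hY : ∀ i j, Measurable (Y i j))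
    (hM₀ : ∀ i, Measurable (fun q : Θ₀ × (Fin i → 𝒴) × 𝒴 => M₀.dens i q.1 (x i) q.2.1 q.2.2))
    (htrue : ∀ n, P.map (dataUpTo Y n) = (refMeasure lam n m).withDensity (M₀.marginal x))
    (n : ℕ) (θ : Θ) : ∫⁻ ω, M.ratio M₀ x Y n θ ω ∂P ≤ 1 := by
  have hf := M₀.measurable_marginal x hM₀ n m
  have hl := M.measurable_lik x n m θ
  have hr : Measurable fun y : Fin n → Fin m → 𝒴 => M.lik x θ y / M₀.marginal x y := hl.div hf
  calc ∫⁻ ω, M.ratio M₀ x Y n θ ω ∂P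
      = ∫⁻ y, M.lik x θ y / M₀.marginal x y ∂(P.map (dataUpTo Y n)) :=
        (lintegral_map hr (measurable_dataUpTo hY n)).symm
    _ = ∫⁻ y, M₀.marginal x y * (M.lik x θ y / M₀.marginal x y) ∂(refMeasure lam n m) := by
        rw [htrue n, lintegral_withDensity_eq_lintegral_mul _ hf hr]
        rfl
    _ ≤ ∫⁻ y, M.lik x θ y ∂(refMeasure lam n m) := lintegral_mono fun y => ENNReal.mul_div_le
    _ = 1 := M.lintegral_lik x n m θ

theorem S1.measurable_ratio (h : M.S1 M₀ x Y) (hY : ∀ i j, Measurable (Y i j)) (n : ℕ) :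
    Measurable fun q : Ω × Θ => M.ratio M₀ x Y n q.2 q.1 :=
  (h n).mono (sup_le_sup (MeasurableSpace.comap_mono (measurable_dataUpTo hY n).comap_le) le_rfl)
    le_rfl

theorem S1.measurable_ratio_right (h : M.S1 M₀ x Y) (hY : ∀ i j, Measurable (Y i j)) (n : ℕ)
    (ω : Ω) : Measurable fun θ => M.ratio M₀ x Y n θ ω :=
  (h.measurable_ratio hY n).of_uncurry_left (f := fun ω θ => M.ratio M₀ x Y n θ ω) (x := ω)

theorem S1.measurable_setLIntegral_ratio (h : M.S1 M₀ x Y) (hY : ∀ i j, Measurable (Y i j))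
    (n : ℕ) (A : Set Θ) : Measurable fun ω => ∫⁻ θ in A, M.ratio M₀ x Y n θ ω ∂M.prior :=
  (h.measurable_ratio hY n).lintegral_prod_right'

/-- The expectation of an integrated likelihood ratio is at most the prior probability. -/
theorem lintegral_setLIntegral_ratio_le [SigmaFinite lam] [IsProbabilityMeasure P]
    (hY : ∀ i j, Measurable (Y i j))
    (hM₀ : ∀ i, Measurable (fun q : Θ₀ × (Fin i → 𝒴) × 𝒴 => M₀.dens i q.1 (x i) q.2.1 q.2.2))
    (htrue : ∀ n, P.map (dataUpTo Y n) = (refMeasure lam n m).withDensity (M₀.marginal x))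
    (hS1 : M.S1 M₀ x Y) (n : ℕ) (A : Set Θ) :
    ∫⁻ ω, ∫⁻ θ in A, M.ratio M₀ x Y n θ ω ∂M.prior ∂P ≤ M.prior A := by
  rw [lintegral_lintegral_swap (f := fun ω θ => M.ratio M₀ x Y n θ ω)
    (hS1.measurable_ratio hY n).aemeasurable]
  calc ∫⁻ θ in A, ∫⁻ ω, M.ratio M₀ x Y n θ ω ∂P ∂M.prior
      ≤ ∫⁻ _ in A, 1 ∂M.prior :=
        lintegral_mono fun θ => lintegral_ratio_le_one hY hM₀ htrue n θ
    _ = M.prior A := by simp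

theorem ae_lintegral_ratio_ne_top [SigmaFinite lam] [IsProbabilityMeasure P]
    (hY : ∀ i j, Measurable (Y i j))
    (hM₀ : ∀ i, Measurable (fun q : Θ₀ × (Fin i → 𝒴) × 𝒴 => M₀.dens i q.1 (x i) q.2.1 q.2.2))
    (htrue : ∀ n, P.map (dataUpTo Y n) = (refMeasure lam n m).withDensity (M₀.marginal x))
    (hS1 : M.S1 M₀ x Y) :
    ∀ᵐ ω ∂P, ∀ n, ∫⁻ θ, M.ratio M₀ x Y n θ ω ∂M.prior ≠ ∞ := by
  rw [ae_all_iff]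
  intro n
  have h := lintegral_setLIntegral_ratio_le hY hM₀ htrue hS1 n Set.univ
  have hm := hS1.measurable_setLIntegral_ratio hY n Set.univ
  simp only [Measure.restrict_univ] at h hm
  filter_upwards [ae_lt_top hm (h.trans_lt (measure_lt_top _ _)).ne] with ω hω using hω.ne

end TrueModel

/-! ### Exponential rates of integrated likelihood ratios -/

section Rates

variable {M : BayesModel Θ 𝒳 𝒴 lam} {M₀ : BayesModel Θ₀ 𝒳 𝒴 lam} {x : ℕ → 𝒳}
  {P : Measure Ω} {Y : ℕ → Fin m → Ω → 𝒴}

/-- The integrated likelihood ratio decreases at most at the exponential rate `h(Θ)`. -/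
theorem exists_le_lintegral_ratio [SFinite P] (hY : ∀ i j, Measurable (Y i j))
    (hS1 : M.S1 M₀ x Y) (hS2 : M.S2 P x Y) (hS3 : M.S3 M₀ P x Y) {u : ℝ}
    (hu : M.klRateOn P x Y Set.univ < ENNReal.ofReal u) :
    ∃ κ : ℝ≥0∞, κ ≠ 0 ∧ κ ≠ ∞ ∧ ∀ᵐ ω ∂P, ∀ᶠ n : ℕ in atTop,
      κ ≤ ENNReal.ofReal (Real.exp (n * u)) * ∫⁻ θ, M.ratio M₀ x Y n θ ω ∂M.prior := by
  have hu0 : 0 < u := ENNReal.ofReal_pos.1 (bot_le.trans_lt hu)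
  set A : Set Θ := {θ | M.klRate P x Y θ < ENNReal.ofReal u} with hA
  have hAm : MeasurableSet A := hS2.2 measurableSet_Iio
  have hA0 : M.prior A ≠ 0 := by
    intro h0
    refine hu.not_ge (le_essInf_of_ae_le _ ?_)
    rw [Measure.restrict_univ]
    filter_upwards [measure_eq_zero_iff_ae_notMem.1 h0] with θ hθ
    simpa [hA] using hθ
  let F : ℕ → Ω → Θ → ℝ≥0∞ := fun n ω θ =>
    ENNReal.ofReal (Real.exp (n * u)) * M.ratio M₀ x Y n θ ω
  have hFm (n : ℕ) : Measurable fun q : Ω × Θ => F n q.1 q.2 :=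
    (hS1.measurable_ratio hY n).const_mul _
  have hlim : ∀ᵐ ω ∂P, ∀ᵐ θ ∂M.prior, θ ∈ A → 1 ≤ liminf (fun n => F n ω θ) atTop := by
    -- (S3) has an exceptional null set depending on `θ`; Fubini exchanges it for one null set of
    -- `ω`, outside which almost every `θ` is good.
    rw [Measure.ae_ae_comm]
    · refine ae_of_all _ fun θ => ?_
      filter_upwards [hS3 θ] with ω hω hθ
      refine le_liminf_of_le (by isBoundedDefault) ?_
      have hlt : ((-u : ℝ) : EReal) < -(M.klRate P x Y θ : EReal) := by
        rw [EReal.coe_neg, EReal.neg_lt_neg_iff, ← max_eq_left hu0.le, ← EReal.coe_ennreal_ofReal]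
        exact_mod_cast hθ
      filter_upwards [hω.eventually_const_lt hlt, eventually_gt_atTop 0] with n hn hn0
      have := (ENNReal.le_log_div_natCast_iff hn0 _).1 hn.le
      calc (1 : ℝ≥0∞) = ENNReal.ofReal (Real.exp (n * u)) * ENNReal.ofReal (Real.exp (n * -u)) := by
            rw [← ENNReal.ofReal_mul (Real.exp_pos _).le, ← Real.exp_add]; simp
        _ ≤ F n ω θ := mul_le_mul_right this _
    · have h1 : MeasurableSet {q : Ω × Θ | q.2 ∈ A} := measurable_snd hAm
      have h2 : MeasurableSet {q : Ω × Θ | 1 ≤ liminf (fun n => F n q.1 q.2) atTop} :=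
        measurableSet_le measurable_const (Measurable.liminf hFm)
      convert h1.compl.union h2 using 1
      ext q
      exact imp_iff_not_or
  -- Fatou gives liminf at least `π(A)`; halving leaves the strict gap needed for an eventual bound.
  refine ⟨M.prior A / 2, by simpa using hA0,
    ENNReal.div_ne_top (measure_ne_top _ _) two_ne_zero, ?_⟩
  filter_upwards [hlim] with ω hω
  have hFω (n : ℕ) : Measurable (F n ω) := (hS1.measurable_ratio_right hY n ω).const_mul _
  have hfatou : M.prior A ≤ liminf (fun n => ∫⁻ θ, F n ω θ ∂M.prior) atTop := by
    calc M.prior A = ∫⁻ _ in A, 1 ∂M.prior := by simp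
      _ ≤ ∫⁻ θ in A, liminf (fun n => F n ω θ) atTop ∂M.prior :=
        lintegral_mono_ae ((ae_restrict_iff' hAm).2 hω)
      _ ≤ ∫⁻ θ, liminf (fun n => F n ω θ) atTop ∂M.prior := setLIntegral_le_lintegral _ _
      _ ≤ _ := lintegral_liminf_le hFω
  have hhalf : M.prior A / 2 < M.prior A := ENNReal.half_lt_self hA0 (measure_ne_top _ _)
  filter_upwards [eventually_lt_of_lt_liminf (hhalf.trans_le hfatou)] with n hn
  rw [← lintegral_const_mul _ (hS1.measurable_ratio_right hY n ω)]
  exact hn.le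

/-- Outside a sieve with exponentially small complements, the integrated likelihood ratio is
eventually exponentially small. -/
theorem ae_eventually_setLIntegral_compl_ratio_le [SigmaFinite lam] [IsProbabilityMeasure P]
    (hY : ∀ i j, Measurable (Y i j))
    (hM₀ : ∀ i, Measurable (fun q : Θ₀ × (Fin i → 𝒴) × 𝒴 => M₀.dens i q.1 (x i) q.2.1 q.2.2))
    (htrue : ∀ n, P.map (dataUpTo Y n) = (refMeasure lam n m).withDensity (M₀.marginal x))
    (hS1 : M.S1 M₀ x Y) {G : ℕ → Set Θ} (hG : ∀ n, MeasurableSet (G n)) {c γ v : ℝ}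
    (hv : v < γ) (hprior : ∀ n : ℕ, 1 - c * Real.exp (-γ * n) ≤ M.prior.real (G n)) :
    ∀ᵐ ω ∂P, ∀ᶠ n : ℕ in atTop, ENNReal.ofReal (Real.exp (n * v)) *
      ∫⁻ θ in (G n)ᶜ, M.ratio M₀ x Y n θ ω ∂M.prior ≤ 1 := by
  let F : ℕ → Ω → ℝ≥0∞ := fun n ω =>
    ENNReal.ofReal (Real.exp (n * v)) * ∫⁻ θ in (G n)ᶜ, M.ratio M₀ x Y n θ ω ∂M.prior
  have hFm (n : ℕ) : Measurable (F n) := (hS1.measurable_setLIntegral_ratio hY n _).const_mul _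
  have hcompl (n : ℕ) : M.prior (G n)ᶜ ≤ ENNReal.ofReal (c * Real.exp (-γ * n)) := by
    rw [← ofReal_measureReal, probReal_compl_eq_one_sub (hG n)]
    exact ENNReal.ofReal_le_ofReal (by linarith [hprior n])
  have hle (n : ℕ) : ∫⁻ ω, F n ω ∂P ≤ ENNReal.ofReal (c * Real.exp (n * -(γ - v))) := by
    calc ∫⁻ ω, F n ω ∂P
        = ENNReal.ofReal (Real.exp (n * v)) *
            ∫⁻ ω, ∫⁻ θ in (G n)ᶜ, M.ratio M₀ x Y n θ ω ∂M.prior ∂P :=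
          lintegral_const_mul _ (hS1.measurable_setLIntegral_ratio hY n _)
      _ ≤ ENNReal.ofReal (Real.exp (n * v)) * ENNReal.ofReal (c * Real.exp (-γ * n)) := by
          gcongr
          exact (lintegral_setLIntegral_ratio_le hY hM₀ htrue hS1 n _).trans (hcompl n)
      _ = ENNReal.ofReal (c * Real.exp (n * -(γ - v))) := by
          rw [← ENNReal.ofReal_mul (Real.exp_pos _).le, mul_left_comm, ← Real.exp_add]
          ring_nf
  -- Borel-Cantelli through expectations: the sum over `n` has finite mean, so it is almost surely
  -- finite and its terms tend to `0`.
  have hsum : ∑' n, ∫⁻ ω, F n ω ∂P ≠ ∞ := by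
    have hs : Summable fun n : ℕ => c * Real.exp (n * -(γ - v)) :=
      (Real.summable_exp_nat_mul_iff.2 (by linarith)).mul_left c
    exact ((ENNReal.tsum_le_tsum hle).trans_lt hs.tsum_ofReal_lt_top).ne
  rw [← lintegral_tsum fun n => (hFm n).aemeasurable] at hsum
  filter_upwards [ae_lt_top (Measurable.tsum hFm) hsum] with ω hω
  have := ENNReal.tendsto_atTop_zero_of_tsum_ne_top hω.ne
  exact this.eventually_le_const one_pos

/-- On a fixed set of the sieve, the integrated likelihood ratio eventually decreases at an
exponential rate at least `h(Θ)`. -/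
theorem ae_limsup_logIntegralRate_le {G : ℕ → Set Θ} (hS2 : M.S2 P x Y)
    (hS5 : M.S5 M₀ P x Y G) (hI : M.UniformOnInfSet M₀ P x Y G) {v : ℝ}
    (hv : ENNReal.ofReal v < M.klRateOn P x Y Set.univ) :
    ∀ᵐ ω ∂P, ∀ N, limsup (fun l => M.logIntegralRate M₀ x Y (G N) l ω) atTop ≤
      ((-v : ℝ) : EReal) := by
  obtain ⟨hG, -, -, hunif, -⟩ := hS5
  have hIm : MeasurableSet (M.infSet P x Y) := hS2.2 (measurableSet_singleton ∞)
  -- The gap `w - v` pays for the error in the uniform convergence off `I`; on `I` the level `-v` is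
  -- available directly.
  obtain ⟨w, hw0, hvw, hw⟩ := ENNReal.lt_iff_exists_real_btwn.1 hv
  replace hvw : v < w := (ENNReal.ofReal_lt_ofReal_iff'.1 hvw).1
  have hinf : ∀ᵐ θ ∂M.prior, ENNReal.ofReal w ≤ M.klRate P x Y θ := by
    have h := ae_essInf_le (f := M.klRate P x Y) (μ := M.prior)
    rw [klRateOn, Measure.restrict_univ] at hw
    filter_upwards [h] with θ hθ using hw.le.trans hθ
  filter_upwards [ae_all_iff.2 hunif, ae_all_iff.2 hI] with ω hω hωI N
  refine limsup_le_of_le (by isBoundedDefault) ?_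
  filter_upwards [hω N (w - v) (sub_pos.2 hvw), hωI N (-v), eventually_gt_atTop 0]
    with n hn hnI hn0
  have hbound : ∀ᵐ θ ∂(M.prior.restrict (G N)),
      M.ratio M₀ x Y n θ ω ≤ ENNReal.ofReal (Real.exp (n * -v)) := by
    rw [ae_restrict_iff' ((hG N).inter hIm)] at hnI
    rw [ae_restrict_iff' (hG N)]
    filter_upwards [hnI, hinf] with θ hθI hθ hθG
    rw [← ENNReal.log_div_natCast_le_iff hn0]
    by_cases hmem : θ ∈ M.infSet P x Y
    · exact hθI ⟨hθG, hmem⟩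
    · refine (hn θ ⟨hθG, hmem⟩).2.trans ?_
      have hle : -(M.klRate P x Y θ : EReal) ≤ ((-w : ℝ) : EReal) := by
        rw [EReal.coe_neg, EReal.neg_le_neg_iff, ← max_eq_left hw0,
          ← EReal.coe_ennreal_ofReal]
        exact_mod_cast hθ
      calc -(M.klRate P x Y θ : EReal) + ((w - v : ℝ) : EReal)
          ≤ ((-w : ℝ) : EReal) + ((w - v : ℝ) : EReal) := by gcongr
        _ = ((-v : ℝ) : EReal) := by rw [← EReal.coe_add]; ring_nf
  rw [logIntegralRate, ENNReal.log_div_natCast_le_iff hn0]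
  calc ∫⁻ θ in G N, M.ratio M₀ x Y n θ ω ∂M.prior
      ≤ ∫⁻ _ in G N, ENNReal.ofReal (Real.exp (n * -v)) ∂M.prior := lintegral_mono_ae hbound
    _ = ENNReal.ofReal (Real.exp (n * -v)) * M.prior (G N) := by simp
    _ ≤ _ := mul_le_of_le_one_right' prob_le_one

/-- The integrated likelihood ratio decreases at least at the exponential rate `h(Θ)`. -/
theorem ae_eventually_lintegral_ratio_le [SigmaFinite lam] [IsProbabilityMeasure P]
    (hY : ∀ i j, Measurable (Y i j))
    (hM₀ : ∀ i, Measurable (fun q : Θ₀ × (Fin i → 𝒴) × 𝒴 => M₀.dens i q.1 (x i) q.2.1 q.2.2))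
    (htrue : ∀ n, P.map (dataUpTo Y n) = (refMeasure lam n m).withDensity (M₀.marginal x))
    {G : ℕ → Set Θ} (hS1 : M.S1 M₀ x Y) (hS2 : M.S2 P x Y) (hS5 : M.S5 M₀ P x Y G)
    (hS6 : M.S6 M₀ P x Y G) (hI : M.UniformOnInfSet M₀ P x Y G) {v : ℝ}
    (hv : ENNReal.ofReal v < M.klRateOn P x Y Set.univ) :
    ∀ᵐ ω ∂P, ∀ᶠ n : ℕ in atTop,
      ENNReal.ofReal (Real.exp (n * v)) * ∫⁻ θ, M.ratio M₀ x Y n θ ω ∂M.prior ≤ 2 := by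
  obtain ⟨w, hw0, hvw, hw⟩ := ENNReal.lt_iff_exists_real_btwn.1 hv
  replace hvw : v < w := (ENNReal.ofReal_lt_ofReal_iff'.1 hvw).1
  obtain ⟨hG, -, ⟨c, γ, -, hγ, hprior⟩, -, -⟩ := id hS5
  have hvγ : v < γ := by
    refine (ENNReal.ofReal_lt_ofReal_iff'.1 (hv.trans_le (le_trans ?_ hγ.le))).1
    exact le_mul_of_one_le_left' one_le_two
  filter_upwards [ae_eventually_setLIntegral_compl_ratio_le hY hM₀ htrue hS1 hG hvγ hprior,
    ae_limsup_logIntegralRate_le hS2 hS5 hI hw, hS6 (w - v) (sub_pos.2 hvw)] with ω hcompl hlim hτ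
  filter_upwards [hcompl, hτ, eventually_gt_atTop 0] with n hn hτn hn0
  -- The bound from (S6) is used on the diagonal, with `G n` at time `n`. The limsup bound holds for
  -- all `N` outside one null set, so `N = n` is allowed; the slack `δ = w - v` degrades `-w` to
  -- `-v`.
  simp only [settlingTime, iInf_lt_iff] at hτn
  obtain ⟨t, ht, htn⟩ := hτn
  have hsieve : ∫⁻ θ in G n, M.ratio M₀ x Y n θ ω ∂M.prior
      ≤ ENNReal.ofReal (Real.exp (n * -v)) := by
    rw [← ENNReal.log_div_natCast_le_iff hn0]
    calc M.logIntegralRate M₀ x Y (G n) n ω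
        ≤ ((w - v : ℝ) : EReal) + ((-w : ℝ) : EReal) :=
          (ht n (by exact_mod_cast htn)).trans (by gcongr; exact hlim n)
      _ = ((-v : ℝ) : EReal) := by rw [← EReal.coe_add]; ring_nf
  rw [← lintegral_add_compl _ (hG n), mul_add, ← one_add_one_eq_two]
  refine add_le_add ?_ hn
  calc _ ≤ ENNReal.ofReal (Real.exp (n * v)) * ENNReal.ofReal (Real.exp (n * -v)) := by gcongr
    _ = 1 := by rw [← ENNReal.ofReal_mul (Real.exp_pos _).le, ← Real.exp_add]; simp

end Rates

end BayesModel

/-! ### From integrated ratios to posterior probabilities -/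

theorem BayesModel.marginal_eq_mul_lintegral_ratio {Θ Θ₀ 𝒳 𝒴 Ω : Type*} [MeasurableSpace Θ]
    [MeasurableSpace Θ₀] [MeasurableSpace 𝒴] {lam : Measure 𝒴} {m : ℕ}
    (M : BayesModel Θ 𝒳 𝒴 lam) (M₀ : BayesModel Θ₀ 𝒳 𝒴 lam) (x : ℕ → 𝒳)
    (Y : ℕ → Fin m → Ω → 𝒴) (n : ℕ) (ω : Ω) (h0 : M₀.marginal x (dataUpTo Y n ω) ≠ 0)
    (hfin : M₀.marginal x (dataUpTo Y n ω) ≠ ∞) :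
    M.marginal x (dataUpTo Y n ω) =
      M₀.marginal x (dataUpTo Y n ω) * ∫⁻ θ, M.ratio M₀ x Y n θ ω ∂M.prior := by
  rw [← lintegral_const_mul' _ _ hfin, marginal]
  refine lintegral_congr fun θ => ?_
  rw [ratio, ENNReal.mul_div_cancel h0 hfin]

/-- The prior on the weights enters the posterior only through the mean of each weight. -/
theorem allocationDensity_eq_mul {K : ℕ} {Θ : Fin K → Type*} {𝒳 𝒴 : Type*}
    [∀ k, MeasurableSpace (Θ k)] [MeasurableSpace 𝒴] {lam : Measure 𝒴}
    (M : ∀ k, BayesModel (Θ k) 𝒳 𝒴 lam) (ρ : Measure (stdSimplex ℝ (Fin K))) (x : ℕ → 𝒳)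
    {n m : ℕ} (y : Fin n → Fin m → 𝒴) (k : Fin K) :
    allocationDensity M ρ x y k = (∫⁻ p, ENNReal.ofReal (p.1 k) ∂ρ) * (M k).marginal x y :=
  lintegral_mul_const _ ((measurable_pi_apply k).comp measurable_subtype_coe).ennreal_ofReal

/-- Every other share is at most `r i`, because the total is at least `D a i₀`. The dominant share
is one minus the rest; a nonzero finite total makes the shares add up to `1`. -/
theorem ENNReal.tendsto_normalized {ι α : Type*} [Fintype ι] [DecidableEq ι] {l : Filter α}
    {D : α → ι → ℝ≥0∞} {i₀ : ι} (h0 : ∀ᶠ a in l, D a i₀ ≠ 0) (htop : ∀ᶠ a in l, ∀ i, D a i ≠ ∞)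
    {r : ι → α → ℝ≥0∞} (hr : ∀ i, Tendsto (r i) l (𝓝 0))
    (hD : ∀ i, i ≠ i₀ → ∀ᶠ a in l, D a i ≤ r i a * D a i₀) (i : ι) :
    Tendsto (fun a => D a i / ∑ j, D a j) l (𝓝 (if i = i₀ then 1 else 0)) := by
  have hzero (i : ι) (hi : i ≠ i₀) : Tendsto (fun a => D a i / ∑ j, D a j) l (𝓝 0) := by
    refine tendsto_of_tendsto_of_tendsto_of_le_of_le' tendsto_const_nhds (hr i)
      (Eventually.of_forall fun _ => bot_le) ?_
    filter_upwards [hD i hi] with a ha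
    refine ENNReal.div_le_of_le_mul (ha.trans ?_)
    gcongr
    exact Finset.single_le_sum (f := D a) (fun _ _ => bot_le) (Finset.mem_univ i₀)
  split_ifs with hi
  · subst hi
    have hsum : Tendsto (fun a => 1 - ∑ j ∈ Finset.univ.erase i, D a j / ∑ j, D a j) l
        (𝓝 (1 - ∑ j ∈ Finset.univ.erase i, 0)) :=
      ENNReal.Tendsto.sub tendsto_const_nhds
        (tendsto_finsetSum _ fun j hj => hzero j (Finset.ne_of_mem_erase hj))
        (Or.inl ENNReal.one_ne_top)
    rw [Finset.sum_const_zero, tsub_zero] at hsum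
    refine hsum.congr' ?_
    filter_upwards [h0, htop] with a ha0 hatop
    have hS0 : ∑ j, D a j ≠ 0 := fun h => ha0 (Finset.sum_eq_zero_iff.1 h i (Finset.mem_univ i))
    have hStop : ∑ j, D a j ≠ ∞ := ENNReal.sum_ne_top.2 fun j _ => hatop j
    have hone : D a i / (∑ j, D a j) + ∑ j ∈ Finset.univ.erase i, D a j / ∑ j, D a j = 1 := by
      rw [Finset.add_sum_erase _ (fun i => D a i / ∑ j, D a j) (Finset.mem_univ i)]
      simp_rw [div_eq_mul_inv]
      rw [← Finset.sum_mul, ENNReal.mul_inv_cancel hS0 hStop]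
    refine (ENNReal.eq_sub_of_add_eq ?_ hone).symm
    refine ENNReal.sum_ne_top.2 fun j _ => ENNReal.div_ne_top (hatop j) hS0
  · exact hzero i hi

theorem mainTheorem1 {K : ℕ} {Θ : Fin K → Type*} {Θ₀ 𝒳 𝒴 Ω : Type*}
    [∀ k, MeasurableSpace (Θ k)] [MeasurableSpace Θ₀] [MeasurableSpace 𝒴] [MeasurableSpace Ω]
    (lam : Measure 𝒴) [SigmaFinite lam]
    (M₀ : BayesModel Θ₀ 𝒳 𝒴 lam) (M : ∀ k, BayesModel (Θ k) 𝒳 𝒴 lam)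
    (ρ : Measure (stdSimplex ℝ (Fin K))) [IsProbabilityMeasure ρ]
    (x : ℕ → 𝒳) (m : ℕ) (hm : 1 ≤ m)
    (P : Measure Ω) [IsProbabilityMeasure P] (Y : ℕ → Fin m → Ω → 𝒴)
    (hY : ∀ i j, Measurable (Y i j))
    (hM₀ : ∀ i, Measurable (fun q : Θ₀ × (Fin i → 𝒴) × 𝒴 => M₀.dens i q.1 (x i) q.2.1 q.2.2))
    (htrue : ∀ n, P.map (dataUpTo Y n) = (refMeasure lam n m).withDensity (M₀.marginal x))
    (hprior : ∀ k θ, 0 < (M k).priorDens θ)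
    (G : ∀ k, ℕ → Set (Θ k))
    (hS1 : ∀ k, (M k).S1 M₀ x Y)
    (hS2 : ∀ k, (M k).S2 P x Y)
    (hS3 : ∀ k, (M k).S3 M₀ P x Y)
    (hS4 : ∀ k, (M k).S4 P x Y)
    (hS5 : ∀ k, (M k).S5 M₀ P x Y (G k))
    (hS6 : ∀ k, (M k).S6 M₀ P x Y (G k))
    (kt : Fin K)
    (hmin : ∀ k, k ≠ kt →
      (M kt).klRateOn P x Y Set.univ < (M k).klRateOn P x Y Set.univ)
    (hkt : 0 < ρ {p | 0 < p.1 kt})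
    (hI : ∀ k, k ≠ kt → (M k).UniformOnInfSet M₀ P x Y (G k)) :
    ∀ᵐ ω ∂P, ∀ k, Tendsto (fun n => allocationPosterior M ρ x (dataUpTo Y n ω) k) atTop
      (𝓝 (if k = kt then 1 else 0)) := by
  set W : Fin K → ℝ≥0∞ := fun k => ∫⁻ p, ENNReal.ofReal (p.1 k) ∂ρ with hW
  have hW1 (k : Fin K) : W k ≤ 1 := by
    calc W k ≤ ∫⁻ _, 1 ∂ρ := lintegral_mono fun p =>
          ENNReal.ofReal_le_one.2 (mem_Icc_of_mem_stdSimplex p.2 k).2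
      _ = 1 := by simp
  have hWtop (k : Fin K) : W k ≠ ∞ := ((hW1 k).trans_lt ENNReal.one_lt_top).ne
  have hWkt : W kt ≠ 0 := by
    have hmeas : Measurable fun p : stdSimplex ℝ (Fin K) => ENNReal.ofReal (p.1 kt) :=
      ((measurable_pi_apply kt).comp measurable_subtype_coe).ennreal_ofReal
    refine ((lintegral_pos_iff_support hmeas).2 ?_).ne'
    simpa [Function.support] using hkt
  -- The rate `r` is deterministic, and the case `k = kt` gets a dummy value so that `choose` yields
  -- one family over all `k`.
  have hbound (k : Fin K) : ∃ r : ℕ → ℝ≥0∞, Tendsto r atTop (𝓝 0) ∧ (k ≠ kt →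
      ∀ᵐ ω ∂P, ∀ᶠ n : ℕ in atTop, ∫⁻ θ, (M k).ratio M₀ x Y n θ ω ∂(M k).prior ≤
        r n * (W kt * ∫⁻ θ, (M kt).ratio M₀ x Y n θ ω ∂(M kt).prior)) := by
    by_cases hk : k = kt
    · exact ⟨0, tendsto_const_nhds, fun h => (h hk).elim⟩
    obtain ⟨u, -, hu, huk⟩ := ENNReal.lt_iff_exists_real_btwn.1 (hmin k hk)
    obtain ⟨v, -, huv, hv⟩ := ENNReal.lt_iff_exists_real_btwn.1 huk
    replace huv : u < v := (ENNReal.ofReal_lt_ofReal_iff'.1 huv).1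
    obtain ⟨κ, hκ, hκfin, hlow⟩ :=
      BayesModel.exists_le_lintegral_ratio hY (hS1 kt) (hS2 kt) (hS3 kt) hu
    have hup := BayesModel.ae_eventually_lintegral_ratio_le hY hM₀ htrue (hS1 k) (hS2 k) (hS5 k)
      (hS6 k) (hI k hk) hv
    have hκtop : κ⁻¹ ≠ ∞ := ENNReal.inv_ne_top.2 hκ
    have hWinv : (W kt)⁻¹ ≠ ∞ := ENNReal.inv_ne_top.2 hWkt
    -- Here `2` comes from the competitor's upper bound, `κ⁻¹` from the lower bound for `kt`, and
    -- `(W kt)⁻¹` offsets the mean weight of `kt`.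
    refine ⟨fun n => 2 * (W kt)⁻¹ * κ⁻¹ * ENNReal.ofReal (Real.exp (n * (u - v))), ?_, fun _ => ?_⟩
    · have hexp : Tendsto (fun n : ℕ => Real.exp (n * (u - v))) atTop (𝓝 0) :=
        (Real.summable_exp_nat_mul_iff.2 (sub_neg.2 huv)).tendsto_atTop_zero
      simpa using ENNReal.Tendsto.const_mul (ENNReal.tendsto_ofReal hexp)
        (Or.inr (ENNReal.mul_ne_top (ENNReal.mul_ne_top ENNReal.ofNat_ne_top hWinv) hκtop))
    · filter_upwards [hlow, hup] with ω hωl hωu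
      filter_upwards [hωl, hωu] with n hnl hnu
      set I := ∫⁻ θ, (M k).ratio M₀ x Y n θ ω ∂(M k).prior
      set J := ∫⁻ θ, (M kt).ratio M₀ x Y n θ ω ∂(M kt).prior
      have hsplit : ENNReal.ofReal (Real.exp (n * (u - v))) =
          ENNReal.ofReal (Real.exp (n * -v)) * ENNReal.ofReal (Real.exp (n * u)) := by
        rw [← ENNReal.ofReal_mul (Real.exp_pos _).le, ← Real.exp_add]
        ring_nf
      have hcancel : ENNReal.ofReal (Real.exp (n * -v)) * ENNReal.ofReal (Real.exp (n * v)) = 1 := by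
        rw [← ENNReal.ofReal_mul (Real.exp_pos _).le, ← Real.exp_add]
        simp
      have hκone : 1 ≤ κ⁻¹ * (ENNReal.ofReal (Real.exp (n * u)) * J) := by
        rw [mul_comm, ← div_eq_mul_inv]
        exact (ENNReal.le_div_iff_mul_le (Or.inl hκ) (Or.inl hκfin)).2 (by simpa using hnl)
      calc I = ENNReal.ofReal (Real.exp (n * -v)) * (ENNReal.ofReal (Real.exp (n * v)) * I) := by
            rw [← mul_assoc, hcancel, one_mul]
        _ ≤ ENNReal.ofReal (Real.exp (n * -v)) * 2 := mul_le_mul_right hnu _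
        _ ≤ ENNReal.ofReal (Real.exp (n * -v)) * 2 *
              (κ⁻¹ * (ENNReal.ofReal (Real.exp (n * u)) * J)) := le_mul_of_one_le_right' hκone
        _ = ((W kt)⁻¹ * W kt) * (ENNReal.ofReal (Real.exp (n * -v)) * 2 *
              (κ⁻¹ * (ENNReal.ofReal (Real.exp (n * u)) * J))) := by
            rw [ENNReal.inv_mul_cancel hWkt (hWtop kt), one_mul]
        _ = _ := by rw [hsplit]; ring
  choose r hr hrle using hbound
  have hrle' : ∀ᵐ ω ∂P, ∀ k, k ≠ kt → ∀ᶠ n : ℕ in atTop,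
      ∫⁻ θ, (M k).ratio M₀ x Y n θ ω ∂(M k).prior ≤
        r k n * (W kt * ∫⁻ θ, (M kt).ratio M₀ x Y n θ ω ∂(M kt).prior) := by
    refine ae_all_iff.2 fun k => ?_
    by_cases hk : k = kt
    · exact ae_of_all _ fun _ h => (h hk).elim
    · filter_upwards [hrle k hk] with ω hω _ using hω
  have hpos : ∀ᵐ ω ∂P, ∀ᶠ n : ℕ in atTop,
      ∫⁻ θ, (M kt).ratio M₀ x Y n θ ω ∂(M kt).prior ≠ 0 := by
    -- With no competitor to supply a level above the rate, `γ` serves as one.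
    obtain ⟨-, -, ⟨c, γ, -, hγ, -⟩, -, -⟩ := hS5 kt
    obtain ⟨κ, hκ, -, hlow⟩ := BayesModel.exists_le_lintegral_ratio hY (hS1 kt) (hS2 kt) (hS3 kt)
      ((le_mul_of_one_le_left' one_le_two).trans_lt hγ)
    filter_upwards [hlow] with ω hω
    filter_upwards [hω] with n hn h
    rw [h, mul_zero] at hn
    exact hκ (le_antisymm hn bot_le)
  filter_upwards [BayesModel.ae_marginal_ne_zero_ne_top hY hM₀ htrue, hrle', hpos,
    ae_all_iff.2 fun k => BayesModel.ae_lintegral_ratio_ne_top hY hM₀ htrue (hS1 k)]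
    with ω hω hωr hωpos hωtop k
  have hD (n : ℕ) (k : Fin K) : allocationDensity M ρ x (dataUpTo Y n ω) k =
      W k * (M₀.marginal x (dataUpTo Y n ω) * ∫⁻ θ, (M k).ratio M₀ x Y n θ ω ∂(M k).prior) := by
    rw [allocationDensity_eq_mul, (M k).marginal_eq_mul_lintegral_ratio M₀ x Y n ω
      (hω n).1 (hω n).2]
  refine ENNReal.tendsto_normalized (D := fun n => allocationDensity M ρ x (dataUpTo Y n ω))
    ?_ (Eventually.of_forall fun n k => ?_) hr (fun k hk => ?_) k
  · filter_upwards [hωpos] with n hn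
    rw [hD]
    exact mul_ne_zero hWkt (mul_ne_zero (hω n).1 hn)
  · rw [hD]
    exact ENNReal.mul_ne_top (hWtop k) (ENNReal.mul_ne_top (hω n).2 (hωtop k n))
  · filter_upwards [hωr k hk] with n hn
    rw [hD, hD]
    refine (mul_le_of_le_one_left' (hW1 k)).trans ?_
    calc _ ≤ M₀.marginal x (dataUpTo Y n ω) * _ := mul_le_mul_right hn _
      _ = _ := by ring
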